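/- For a partition $\lambda=(\lambda_1\ge\cdots\ge\lambda_r\ge 1)$ let $|\lambda|=\lambda_1+\cdots+\lambda_r$ be its size and $\widehat N(\lambda)=\prod_{i=1}^r p_{\lambda_i}$ its supernorm, where $p_k$ is the $k$-th prime in increasing order ($p_1=2$); the empty partition has size $0$ and $\widehat N(\emptyset)=1$. For an integer $n\ge 0$ put $$\widehat C_{\mathrm{size}}(n)=\sum_{\lambda:\,|\lambda|\le n}\frac{1}{\widehat N(\lambda)},$$ the sum running over all partitions of size at most $n$, including the empty one. Let $\gamma$ be Euler's constant. Then there are absolute constants $C_1$ and $C_2$ such that, for all integers $n\ge 10$, $$\widehat C_{\mathrm{size}}(n)\ \ge\ e^{\gamma}\log n-C_1$$ and $$\bigl|\widehat C_{\mathrm{size}}(n)-e^{\gamma}\log n\bigr|\ \le\ C_2\log\log n .$$ -/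

import Mathlib

/-- The `k`-th prime `p_k` in increasing order, with `p_1 = 2`, and with the convention `p_0 = 1`.
(`Nat.nth` counts from `0`.) -/
noncomputable def pdx (k : ℕ) : ℕ :=
  if k = 0 then 1 else Nat.nth Nat.Prime (k - 1)

/-- The supernorm of a partition: the product of the primes indexed by its parts, taken with
multiplicity. The empty partition has supernorm `1`. -/
noncomputable def supernorm {m : ℕ} (lam : Nat.Partition m) : ℕ :=
  (lam.parts.map pdx).prod

/-- The sum of the reciprocal supernorms of all partitions of size at most `n`
(the empty partition, of size `0`, included). -/
noncomputable def cumSize (n : ℕ) : ℝ :=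
  ∑ m ∈ Finset.range (n + 1), ∑ lam : Nat.Partition m, 1 / (supernorm lam : ℝ)

/-! By unique factorization the supernorm is a bijection from partitions onto positive integers, and
size becomes the additive function `primeIndexSum`. So `cumSize n` sums 1/k over the k with
`primeIndexSum k ≤ n`, to be compared with P(y) = ∏_{p ≤ y} (1 - 1/p)⁻¹ = e^γ log y + O(1).

Upper bound (`cumSize_le_eulerProd`): such k have no prime factor beyond p_n, so the sum is at most
P(p_n). Chebyshev gives p_n ≤ 12 n log n, and the extra factor log n costs the log log n.

Lower bound (`eulerProd_mul_le_cumSize`): for z = 1 - 1/n, the function (z^s - z^n)/(1 - z^n) of the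
size s is at most the indicator of s ≤ n. Its sum over n-smooth integers is computed from two Euler
products. Each tilted Euler factor loses at most a factor z, so the result is at least P(n)(1 -
2π(n)/n), and P(n)π(n)/n = O(1).

Mertens' third theorem is proved on the way. Factoring n! gives the first theorem; partial summation
gives log P(n) = log log n + c + O(1/log n). To find c, log P(e^x) is compared with the harmonic sum
up to x: their difference tends to c - γ, while both Laplace transforms are -log ε + o(1), by the
pole of ζ at 1. An Abelian theorem then forces c = γ (`eq_eulerMascheroniConstant`). -/

open Filter Topology Finset

/-! ### Euler factors and their logarithms -/

/-- The logarithm of the Euler factor `(1 - 1/p)⁻¹`. -/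
noncomputable def eulerWeight (p : ℕ) : ℝ := -Real.log (1 - (p : ℝ)⁻¹)

/-- The partial Euler product over the primes up to `n`. -/
noncomputable def eulerProd (n : ℕ) : ℝ := ∏ p ∈ Nat.primesLE n, (1 - (p : ℝ)⁻¹)⁻¹

theorem le_neg_log_one_sub {x : ℝ} (hx : x < 1) : x ≤ -Real.log (1 - x) := by
  have := Real.log_le_sub_one_of_pos (show 0 < 1 - x by linarith)
  linarith

theorem neg_log_one_sub_le {x : ℝ} (hx : x < 1) : -Real.log (1 - x) ≤ x / (1 - x) := by
  have h0 : 0 < 1 - x := by linarith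
  have := Real.one_sub_inv_le_log_of_pos h0
  have h2 : x / (1 - x) = (1 - x)⁻¹ - 1 := by field_simp; ring
  linarith

theorem one_div_prime_lt_one {p : ℕ} (hp : 2 ≤ p) : (p : ℝ)⁻¹ < 1 :=
  inv_lt_one_of_one_lt₀ (by exact_mod_cast hp)

theorem inv_le_eulerWeight {p : ℕ} (hp : 2 ≤ p) : (p : ℝ)⁻¹ ≤ eulerWeight p :=
  le_neg_log_one_sub (one_div_prime_lt_one hp)

theorem eulerWeight_le {p : ℕ} (hp : 2 ≤ p) : eulerWeight p ≤ ((p : ℝ) - 1)⁻¹ := by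
  have h2 : (2 : ℝ) ≤ p := by exact_mod_cast hp
  refine (neg_log_one_sub_le (one_div_prime_lt_one hp)).trans_eq ?_
  have : (p : ℝ) - 1 ≠ 0 := by linarith
  field_simp

theorem eulerWeight_nonneg (p : ℕ) : 0 ≤ eulerWeight p := by
  rcases lt_or_ge p 2 with h | h
  · interval_cases p <;> simp [eulerWeight]
  · exact le_trans (by positivity) (inv_le_eulerWeight h)

theorem eulerProd_pos (n : ℕ) : 0 < eulerProd n := by
  refine prod_pos fun p hp => inv_pos.2 ?_
  linarith [one_div_prime_lt_one (Nat.two_le_of_mem_primesLE hp)]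

theorem log_eulerProd (n : ℕ) : Real.log (eulerProd n) = ∑ p ∈ Nat.primesLE n, eulerWeight p := by
  rw [eulerProd, Real.log_prod]
  · simp [eulerWeight, Real.log_inv]
  · intro p hp
    have := one_div_prime_lt_one (Nat.two_le_of_mem_primesLE hp)
    exact inv_ne_zero (by linarith)

/-! ### Mertens' first theorem -/

theorem log_factorial_eq_sum_primesLE (n : ℕ) :
    Real.log (n.factorial : ℝ) =
      ∑ p ∈ Nat.primesLE n, (padicValNat p n.factorial : ℝ) * Real.log p := by
  have h0 := Nat.factorial_ne_zero n
  have hsupp : n.factorial.factorization.support ⊆ Nat.primesLE n := by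
    intro p hp
    rw [Nat.support_factorization, Nat.mem_primeFactors] at hp
    exact Nat.mem_primesLE.2 ⟨(hp.1.dvd_factorial).1 hp.2.1, hp.1⟩
  conv_lhs => rw [← Nat.prod_factorization_pow_eq_self h0]
  rw [Finsupp.prod_of_support_subset _ hsupp _ (by simp), Nat.cast_prod, Real.log_prod]
  · refine sum_congr rfl fun p hp => ?_
    rw [Nat.cast_pow, Real.log_pow, Nat.factorization_def _ (Nat.prime_of_mem_primesLE hp)]
  · intro p hp
    have := (Nat.prime_of_mem_primesLE hp).ne_zero
    positivity

/-- Since v_p(n!) ≥ ⌊n/p⌋ ≥ n/p - 1, replacing v_p(n!) by n/p in log n! costs at most log p for each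
prime, hence θ(n) ≤ n log 4 in total. -/
theorem sum_log_div_le (n : ℕ) (hn : 1 ≤ n) :
    ∑ p ∈ Nat.primesLE n, Real.log p * (p : ℝ)⁻¹ ≤ Real.log n + Real.log 4 := by
  have hn0 : (0 : ℝ) < n := by exact_mod_cast hn
  have h1 : (n : ℝ) * ∑ p ∈ Nat.primesLE n, Real.log p * (p : ℝ)⁻¹ ≤
      Real.log n.factorial + Chebyshev.theta n := by
    rw [log_factorial_eq_sum_primesLE, Chebyshev.theta_eq_sum_primesLE_log, ← sum_add_distrib,
      mul_sum]
    refine sum_le_sum fun p hp => ?_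
    have hpp := Nat.prime_of_mem_primesLE hp
    have hple := Nat.le_of_mem_primesLE hp
    have := Fact.mk hpp
    have hfl : n / p ≤ padicValNat p n.factorial := by
      -- Only the first term of Legendre's formula is kept; the cutoff is large enough for the index
      -- 1 to lie in the range.
      rw [padicValNat_factorial (b := Nat.log p n + 2) (by omega)]
      have h1 : 1 ∈ Ico 1 (Nat.log p n + 2) := by simp
      simpa using single_le_sum (f := fun i => n / p ^ i) (fun _ _ => Nat.zero_le _) h1
    have h2 : (n : ℝ) / p ≤ (padicValNat p n.factorial : ℝ) + 1 := by
      have := (Nat.lt_floor_add_one ((n : ℝ) / p)).le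
      rw [Nat.floor_div_natCast, Nat.floor_natCast] at this
      have h3 : ((n / p : ℕ) : ℝ) ≤ padicValNat p n.factorial := by exact_mod_cast hfl
      linarith
    have hl : 0 ≤ Real.log p := Real.log_natCast_nonneg p
    calc (n : ℝ) * (Real.log p * (p : ℝ)⁻¹) = ((n : ℝ) / p) * Real.log p := by ring
      _ ≤ _ := by nlinarith
  have h2 : Real.log n.factorial ≤ n * Real.log n := by
    rw [← Real.log_pow]
    refine Real.log_le_log (by positivity) ?_
    exact_mod_cast Nat.factorial_le_pow n
  have h3 := Chebyshev.theta_le_log4_mul_x hn0.le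
  refine le_of_mul_le_mul_left ?_ hn0
  linarith

/-- Legendre's digit-sum formula gives (p - 1) v_p(n!) < n, and n^n / n! ≤ e^n gives log n! ≥ n log
n - n. -/
theorem le_sum_log_div_sub_one (n : ℕ) (hn : 1 ≤ n) :
    Real.log n - 1 ≤ ∑ p ∈ Nat.primesLE n, Real.log p * ((p : ℝ) - 1)⁻¹ := by
  have hn0 : (0 : ℝ) < n := by exact_mod_cast hn
  have h1 : Real.log n.factorial ≤
      (n : ℝ) * ∑ p ∈ Nat.primesLE n, Real.log p * ((p : ℝ) - 1)⁻¹ := by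
    rw [log_factorial_eq_sum_primesLE, mul_sum]
    refine sum_le_sum fun p hp => ?_
    have hpp := Nat.prime_of_mem_primesLE hp
    have := Fact.mk hpp
    have h2 : (2 : ℝ) ≤ p := by exact_mod_cast hpp.two_le
    have hfl := (sub_one_mul_padicValNat_factorial_lt_of_ne_zero (p := p)
      (show n ≠ 0 by omega)).le
    have hfl' : ((p : ℝ) - 1) * padicValNat p n.factorial ≤ n := by
      have : (((p - 1) * padicValNat p n.factorial : ℕ) : ℝ) ≤ n := by exact_mod_cast hfl
      rwa [Nat.cast_mul, Nat.cast_pred hpp.pos] at this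
    have h3 : (padicValNat p n.factorial : ℝ) ≤ n * ((p : ℝ) - 1)⁻¹ := by
      rw [← div_eq_mul_inv, le_div_iff₀ (by linarith)]
      linarith
    have hl : 0 ≤ Real.log p := Real.log_natCast_nonneg p
    nlinarith
  have h2 : (n : ℝ) * Real.log n - n ≤ Real.log n.factorial := by
    have h := Real.pow_div_factorial_le_exp (n : ℝ) hn0.le n
    have h' := Real.log_le_log (by positivity) h
    rw [Real.log_exp, Real.log_div (by positivity) (by positivity), Real.log_pow] at h'
    linarith
  refine le_of_mul_le_mul_left ?_ hn0
  linarith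

/-- This controls the gap between the weights 1/p and 1/(p - 1), which enclose `eulerWeight p`. The
terms are O(n^(-3/2)), because log n ≤ 2√n. -/
theorem summable_log_div_mul_sub_one :
    Summable fun n : ℕ => Real.log n * ((n : ℝ)⁻¹ * ((n : ℝ) - 1)⁻¹) := by
  have hs : Summable fun n : ℕ => 4 * (1 / (n : ℝ) ^ (3 / 2 : ℝ)) :=
    (Real.summable_one_div_nat_rpow.2 (by norm_num)).mul_left 4
  refine Summable.of_nonneg_of_le (fun n => ?_) (fun n => ?_) hs
  · rcases lt_or_ge n 2 with h | h
    · interval_cases n <;> simp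
    · have h2 : (2 : ℝ) ≤ n := by exact_mod_cast h
      have := Real.log_natCast_nonneg n
      have h1 : (0 : ℝ) ≤ ((n : ℝ) - 1)⁻¹ := inv_nonneg.2 (by linarith)
      positivity
  · rcases lt_or_ge n 2 with h | h
    · interval_cases n <;> simp
    · have h2 : (2 : ℝ) ≤ n := by exact_mod_cast h
      have hn : (0 : ℝ) < n := by linarith
      have hl := Real.log_le_rpow_div hn.le (show (0 : ℝ) < 1 / 2 by norm_num)
      have h1 : ((n : ℝ) - 1)⁻¹ ≤ 2 * (n : ℝ)⁻¹ := by
        rw [← div_eq_mul_inv, inv_eq_one_div, div_le_div_iff₀ (by linarith) hn]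
        linarith
      have h0 : (0 : ℝ) ≤ ((n : ℝ) - 1)⁻¹ := inv_nonneg.2 (by linarith)
      calc Real.log n * ((n : ℝ)⁻¹ * ((n : ℝ) - 1)⁻¹)
          ≤ ((n : ℝ) ^ (1 / 2 : ℝ) / (1 / 2)) * ((n : ℝ)⁻¹ * (2 * (n : ℝ)⁻¹)) := by gcongr
        _ = 4 * ((n : ℝ) ^ (1 / 2 : ℝ) * ((n : ℝ) ^ (2 : ℕ))⁻¹) := by
            rw [pow_two, mul_inv]; ring
        _ = 4 * (1 / (n : ℝ) ^ (3 / 2 : ℝ)) := by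
            rw [one_div ((n : ℝ) ^ (3 / 2 : ℝ)), ← Real.rpow_natCast, ← Real.rpow_neg hn.le, ← Real.rpow_neg hn.le,
              ← Real.rpow_add hn]
            norm_num

/-- A form of Mertens' first theorem. -/
theorem exists_abs_sum_eulerWeight_mul_log_sub_log_le :
    ∃ C : ℝ, ∀ n : ℕ, 1 ≤ n →
      |∑ p ∈ Nat.primesLE n, eulerWeight p * Real.log p - Real.log n| ≤ C := by
  set K : ℝ := ∑' n : ℕ, Real.log n * ((n : ℝ)⁻¹ * ((n : ℝ) - 1)⁻¹) with hK
  have hterm : ∀ n : ℕ, 0 ≤ Real.log n * ((n : ℝ)⁻¹ * ((n : ℝ) - 1)⁻¹) := by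
    intro n
    rcases lt_or_ge n 2 with h | h
    · interval_cases n <;> simp
    · have h2 : (2 : ℝ) ≤ n := by exact_mod_cast h
      have := Real.log_natCast_nonneg n
      have h1 : (0 : ℝ) ≤ ((n : ℝ) - 1)⁻¹ := inv_nonneg.2 (by linarith)
      positivity
  refine ⟨Real.log 4 + 1 + K, fun n hn => ?_⟩
  have hKn : ∑ p ∈ Nat.primesLE n, Real.log p * ((p : ℝ) - 1)⁻¹ ≤
      ∑ p ∈ Nat.primesLE n, Real.log p * (p : ℝ)⁻¹ + K := by
    have h1 : ∑ p ∈ Nat.primesLE n, Real.log p * ((p : ℝ)⁻¹ * ((p : ℝ) - 1)⁻¹) ≤ K :=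
      summable_log_div_mul_sub_one.sum_le_tsum _ fun i _ => hterm i
    refine le_trans (le_of_eq ?_) (add_le_add_right h1 _)
    rw [← sum_add_distrib]
    refine sum_congr rfl fun p hp => ?_
    have h2 : (2 : ℝ) ≤ p := by exact_mod_cast Nat.two_le_of_mem_primesLE hp
    have h3 : (p : ℝ) - 1 ≠ 0 := by linarith
    field_simp
    ring
  have hlow : ∑ p ∈ Nat.primesLE n, Real.log p * (p : ℝ)⁻¹ ≤
      ∑ p ∈ Nat.primesLE n, eulerWeight p * Real.log p := by
    refine sum_le_sum fun p hp => ?_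
    rw [mul_comm]
    exact mul_le_mul_of_nonneg_right (inv_le_eulerWeight (Nat.two_le_of_mem_primesLE hp))
      (Real.log_natCast_nonneg p)
  have hup : ∑ p ∈ Nat.primesLE n, eulerWeight p * Real.log p ≤
      ∑ p ∈ Nat.primesLE n, Real.log p * ((p : ℝ) - 1)⁻¹ := by
    refine sum_le_sum fun p hp => ?_
    rw [mul_comm]
    exact mul_le_mul_of_nonneg_left (eulerWeight_le (Nat.two_le_of_mem_primesLE hp))
      (Real.log_natCast_nonneg p)
  have a1 := sum_log_div_le n hn
  have a2 := le_sum_log_div_sub_one n hn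
  have a3 : 0 ≤ Real.log 4 := Real.log_nonneg (by norm_num)
  have a4 : 0 ≤ K := tsum_nonneg hterm
  rw [abs_le]
  constructor <;> linarith

/-! ### Partial summation and the shape of Mertens' third theorem -/

/-- Partial summation against `1 / log`: if the partial sums of `a` are `log n + O(1)`, then those
of `a k / log k` are `log log n + c + O(1 / log n)`. -/
theorem exists_abs_sum_div_log_sub_log_log_le (a : ℕ → ℝ) (C : ℝ)
    (hC : ∀ n : ℕ, 1 ≤ n → |∑ k ∈ range (n + 1), a k - Real.log n| ≤ C) :
    ∃ c K : ℝ, ∀ n : ℕ, 2 ≤ n →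
      |∑ k ∈ range (n + 1), a k / Real.log k - Real.log (Real.log n) - c| ≤ K / Real.log n := by
  have hC0 : 0 ≤ C := (abs_nonneg _).trans (hC 1 le_rfl)
  let R : ℕ → ℝ := fun n => ∑ k ∈ range (n + 1), a k - Real.log n
  -- Subtracting R n / log n removes the boundary term of the partial summation, so the increments
  -- of E are bounded by those of a telescoping sequence.
  let E : ℕ → ℝ := fun n =>
    ∑ k ∈ range (n + 1), a k / Real.log k - Real.log (Real.log n) - R n / Real.log n
  have hlog : ∀ n : ℕ, 2 ≤ n → 0 < Real.log n := fun n hn =>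
    Real.log_pos (by exact_mod_cast hn)
  have hstep : ∀ n : ℕ, 2 ≤ n → |E (n + 1) - E n| ≤
      (C + 1) * (1 / Real.log n - 1 / Real.log (n + 1 : ℕ)) := by
    intro n hn
    set v := Real.log n with hv
    set u := Real.log (n + 1 : ℕ) with hu
    have hv0 : 0 < v := hlog n hn
    have hn0 : (0 : ℝ) < n := by positivity
    have hvu : v < u := Real.log_lt_log hn0 (by push_cast; linarith)
    have hu0 : 0 < u := hv0.trans hvu
    have huv1 : u - v ≤ 1 := by
      rw [hu, hv, ← Real.log_div (by positivity) (by positivity)]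
      refine (Real.log_le_sub_one_of_pos (by positivity)).trans ?_
      have h2 : (2 : ℝ) ≤ n := by exact_mod_cast hn
      rw [div_sub_one hn0.ne', div_le_one hn0]
      push_cast; linarith
    have hR : R (n + 1) = R n + a (n + 1) - u + v := by
      simp only [R, sum_range_succ _ (n + 1)]
      ring
    have hE : E (n + 1) - E n = ((u - v) / u - Real.log (u / v)) + R n * (1 / v - 1 / u) := by
      simp only [E, sum_range_succ _ (n + 1)]
      rw [hR, Real.log_div hu0.ne' hv0.ne', ← hu, ← hv]
      field_simp
      ring
    have hRn : |R n| ≤ C := hC n (by omega)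
    have hd : 0 ≤ 1 / v - 1 / u := by
      rw [sub_nonneg]; exact one_div_le_one_div_of_le hv0 hvu.le
    -- log(u/v) lies between (u - v)/u and (u - v)/v, which differ by (u - v)(1/v - 1/u), and u - v
    -- ≤ 1.
    have h1 : |(u - v) / u - Real.log (u / v)| ≤ 1 / v - 1 / u := by
      have e1 := Real.one_sub_inv_le_log_of_pos (div_pos hu0 hv0)
      have e2 := Real.log_le_sub_one_of_pos (div_pos hu0 hv0)
      have e3 : 1 - (u / v)⁻¹ = (u - v) / u := by field_simp
      have e4 : u / v - 1 = (u - v) / v := by field_simp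
      rw [e3] at e1
      rw [e4] at e2
      have e5 : (u - v) / v - (u - v) / u ≤ 1 / v - 1 / u := by
        have : (u - v) / v - (u - v) / u = (u - v) * (1 / v - 1 / u) := by ring
        rw [this]
        nlinarith
      rw [abs_le]
      constructor <;> linarith
    rw [hE]
    refine (abs_add_le _ _).trans ?_
    rw [abs_mul, abs_of_nonneg hd]
    nlinarith [mul_le_mul_of_nonneg_right hRn hd]
  have hanti : Antitone fun n : ℕ => E (n + 2) + (C + 1) * (1 / Real.log (n + 2 : ℕ)) := by
    refine antitone_nat_of_succ_le fun n => ?_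
    have := (abs_le.1 (hstep (n + 2) (by omega))).2
    have e : n + 1 + 2 = n + 2 + 1 := by ring
    rw [e]
    linarith
  have hmono : Monotone fun n : ℕ => E (n + 2) - (C + 1) * (1 / Real.log (n + 2 : ℕ)) := by
    refine monotone_nat_of_le_succ fun n => ?_
    have := (abs_le.1 (hstep (n + 2) (by omega))).1
    have e : n + 1 + 2 = n + 2 + 1 := by ring
    rw [e]
    linarith
  have hle : ∀ m n : ℕ, E (m + 2) - (C + 1) * (1 / Real.log (m + 2 : ℕ)) ≤
      E (n + 2) + (C + 1) * (1 / Real.log (n + 2 : ℕ)) := by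
    intro m n
    have h1 := hmono (le_max_left m n)
    have h2 := hanti (le_max_right m n)
    have h3 : 0 ≤ (C + 1) * (1 / Real.log (max m n + 2 : ℕ)) := by
      have := hlog (max m n + 2) (by omega)
      positivity
    simp only at h1 h2
    linarith
  -- The constant c separates the increasing sequence E - (C+1)/log from the decreasing E +
  -- (C+1)/log. In 2C + 1, the part C comes from R/log and C + 1 from this enclosure.
  refine ⟨⨆ m : ℕ, (E (m + 2) - (C + 1) * (1 / Real.log (m + 2 : ℕ))), 2 * C + 1, fun n hn => ?_⟩
  obtain ⟨k, rfl⟩ : ∃ k, n = k + 2 := ⟨n - 2, by omega⟩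
  have hlo : E (k + 2) - (C + 1) * (1 / Real.log (k + 2 : ℕ)) ≤
      ⨆ m : ℕ, (E (m + 2) - (C + 1) * (1 / Real.log (m + 2 : ℕ))) :=
    le_ciSup (f := fun m : ℕ => E (m + 2) - (C + 1) * (1 / Real.log (m + 2 : ℕ)))
      ⟨_, by rintro _ ⟨m, rfl⟩; exact hle m 0⟩ k
  have hhi : ⨆ m : ℕ, (E (m + 2) - (C + 1) * (1 / Real.log (m + 2 : ℕ))) ≤
      E (k + 2) + (C + 1) * (1 / Real.log (k + 2 : ℕ)) := ciSup_le fun m => hle m k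
  have hl := hlog (k + 2) hn
  have hRn : |R (k + 2)| ≤ C := hC (k + 2) (by omega)
  have hR' : |R (k + 2) / Real.log (k + 2 : ℕ)| ≤ C / Real.log (k + 2 : ℕ) := by
    rw [abs_div, abs_of_pos hl]
    gcongr
  have hEk : E (k + 2) = ∑ k ∈ range (k + 2 + 1), a k / Real.log k -
    Real.log (Real.log (k + 2 : ℕ)) - R (k + 2) / Real.log (k + 2 : ℕ) := rfl
  have e : (2 * C + 1) / Real.log (k + 2 : ℕ) =
    C / Real.log (k + 2 : ℕ) + (C + 1) * (1 / Real.log (k + 2 : ℕ)) := by ring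
  rw [e]
  rw [abs_le] at hR' ⊢
  constructor <;> linarith

theorem exists_abs_log_eulerProd_sub_le :
    ∃ c K : ℝ, ∀ n : ℕ, 2 ≤ n →
      |Real.log (eulerProd n) - Real.log (Real.log n) - c| ≤ K / Real.log n := by
  obtain ⟨C, hC⟩ := exists_abs_sum_eulerWeight_mul_log_sub_log_le
  have key := exists_abs_sum_div_log_sub_log_log_le
    (fun k => if k.Prime then eulerWeight k * Real.log k else 0) C ?_
  · obtain ⟨c, K, h⟩ := key
    refine ⟨c, K, fun n hn => ?_⟩
    convert h n hn using 4
    rw [log_eulerProd, Nat.primesLE_eq_filter_range, sum_filter]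
    refine sum_congr rfl fun p _ => ?_
    split_ifs with hp
    · have : Real.log p ≠ 0 := (Real.log_pos (by exact_mod_cast hp.one_lt)).ne'
      field_simp
    · simp
  · intro n hn
    have := hC n hn
    rwa [Nat.primesLE_eq_filter_range, sum_filter] at this

/-! ### Laplace transforms and an Abelian theorem -/

/-- The Laplace–Stieltjes transform of a step function. -/
theorem integral_exp_neg_mul_step {ι : Type*} [Countable ι] (a t : ι → ℝ) (ha : ∀ i, 0 ≤ a i)
    (ht : ∀ i, 0 ≤ t i) (S : ℝ → ℝ)
    (hS : ∀ x : ℝ, 0 < x → ∑' i, (if t i ≤ x then a i else 0) = S x)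
    {ε : ℝ} (hε : 0 < ε) (hsum : Summable fun i => a i * Real.exp (-(ε * t i))) :
    ∫ u in Set.Ioi (0 : ℝ), Real.exp (-u) * S (u / ε) = ∑' i, a i * Real.exp (-(ε * t i)) := by
  -- Each jump contributes a i times the integral of exp(-u) over u ≥ ε t i; nonnegativity lets sum
  -- and integral be exchanged.
  let F : ι → ℝ → ℝ := fun i u => Real.exp (-u) * (if t i ≤ u / ε then a i else 0)
  have hF : ∀ i, F i = (Set.Ici (ε * t i)).indicator fun u => a i * Real.exp (-u) := by
    intro i
    funext u
    by_cases h : t i ≤ u / ε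
    · have h' : u ∈ Set.Ici (ε * t i) := by
        rw [le_div_iff₀ hε] at h; rw [Set.mem_Ici]; linarith
      rw [Set.indicator_of_mem h']
      simp [F, h, mul_comm]
    · have h' : u ∉ Set.Ici (ε * t i) := by
        rw [le_div_iff₀ hε] at h; rw [Set.mem_Ici]; linarith
      rw [Set.indicator_of_notMem h']
      simp [F, h]
  have hint : ∀ i, MeasureTheory.Integrable (F i) (MeasureTheory.volume.restrict (Set.Ioi 0)) := by
    intro i
    rw [hF]
    exact ((integrableOn_exp_neg_Ioi 0).const_mul (a i)).indicator measurableSet_Ici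
  have hval : ∀ i, ∫ u in Set.Ioi (0 : ℝ), F i u = a i * Real.exp (-(ε * t i)) := by
    intro i
    have h0 : 0 ≤ ε * t i := mul_nonneg hε.le (ht i)
    rw [hF, MeasureTheory.setIntegral_indicator measurableSet_Ici,
      MeasureTheory.integral_const_mul, ← integral_exp_neg_Ioi]
    congr 1
    rw [Set.inter_comm]
    rcases h0.eq_or_lt with h | h
    · rw [← h, Set.inter_eq_right.2 Set.Ioi_subset_Ici_self]
    · rw [Set.inter_eq_left.2 (Set.Ici_subset_Ioi.2 h), MeasureTheory.integral_Ici_eq_integral_Ioi]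
  have hnorm : ∀ i u, ‖F i u‖ = F i u := by
    intro i u
    refine Real.norm_of_nonneg (mul_nonneg (Real.exp_pos _).le ?_)
    split_ifs
    exacts [ha i, le_rfl]
  have key := MeasureTheory.hasSum_integral_of_summable_integral_norm hint (by
    simp only [hnorm, hval]; exact hsum)
  simp only [hval] at key
  rw [key.tsum_eq]
  refine MeasureTheory.setIntegral_congr_fun measurableSet_Ioi fun u hu => ?_
  simp only [F, tsum_mul_left]
  rw [hS _ (div_pos hu hε)]

/-- An Abelian theorem for the Laplace transform. -/
theorem tendsto_integral_exp_neg_mul (G : ℝ → ℝ) (hG : Measurable G) (B : ℝ)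
    (hB : ∀ x, 0 < x → |G x| ≤ B) (l : ℝ) (hl : Tendsto G atTop (𝓝 l)) :
    Tendsto (fun ε : ℝ => ∫ u in Set.Ioi (0 : ℝ), Real.exp (-u) * G (u / ε)) (𝓝[>] 0) (𝓝 l) := by
  have h1 : ∫ u in Set.Ioi (0 : ℝ), Real.exp (-u) * l = l := by
    rw [MeasureTheory.integral_mul_const, integral_exp_neg_Ioi_zero, one_mul]
  rw [← h1]
  refine MeasureTheory.tendsto_integral_filter_of_dominated_convergence
    (fun u => Real.exp (-u) * B) ?_ ?_ ?_ ?_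
  · refine Eventually.of_forall fun ε => ?_
    exact ((Real.measurable_exp.comp measurable_neg).mul
      (hG.comp (measurable_id.div_const ε))).aestronglyMeasurable
  · filter_upwards [self_mem_nhdsWithin] with ε hε
    refine (MeasureTheory.ae_restrict_iff' measurableSet_Ioi).2 (Eventually.of_forall fun u hu => ?_)
    rw [norm_mul, Real.norm_of_nonneg (Real.exp_pos _).le]
    exact mul_le_mul_of_nonneg_left (hB _ (div_pos hu hε)) (Real.exp_pos _).le
  · exact (integrableOn_exp_neg_Ioi 0).mul_const B
  · refine (MeasureTheory.ae_restrict_iff' measurableSet_Ioi).2 (Eventually.of_forall fun u hu => ?_)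
    have hdiv : Tendsto (fun ε : ℝ => u / ε) (𝓝[>] 0) atTop := by
      simp only [div_eq_mul_inv]
      exact Tendsto.const_mul_atTop hu tendsto_inv_nhdsGT_zero
    exact (hl.comp hdiv).const_mul _

/-- Beyond some T the limit bounds the difference; before T monotonicity and nonnegativity bound it
by S T + H T. This supplies the domination in the Abelian theorem. -/
theorem Monotone.abs_sub_le_of_tendsto {S H : ℝ → ℝ} (hS : Monotone S) (hH : Monotone H)
    (hS0 : ∀ x, 0 ≤ S x) (hH0 : ∀ x, 0 ≤ H x) {l : ℝ}
    (hl : Tendsto (fun x => S x - H x) atTop (𝓝 l)) : ∃ B, ∀ x, |S x - H x| ≤ B := by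
  obtain ⟨T, hT⟩ := eventually_atTop.1 (hl.abs.eventually (gt_mem_nhds (lt_add_one |l|)))
  refine ⟨max (|l| + 1) (S T + H T), fun x => ?_⟩
  rcases le_total T x with h | h
  · exact (hT x h).le.trans (le_max_left _ _)
  · refine le_trans ?_ (le_max_right _ _)
    have := hS h; have := hH h; have := hS0 x; have := hH0 x
    rw [abs_le]; constructor <;> linarith

/-! ### The two step functions: Euler products and harmonic sums -/

theorem monotone_log_eulerProd : Monotone fun n : ℕ => Real.log (eulerProd n) := by
  intro m n h
  simp only [log_eulerProd]
  exact sum_le_sum_of_subset_of_nonneg (Nat.primesLE_mono h) fun p _ _ => eulerWeight_nonneg p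

theorem log_eulerProd_nonneg (n : ℕ) : 0 ≤ Real.log (eulerProd n) := by
  rw [log_eulerProd]; exact sum_nonneg fun p _ => eulerWeight_nonneg p

theorem tendsto_log_floor_exp_div : Tendsto (fun x : ℝ => Real.log ⌊Real.exp x⌋₊ / x) atTop (𝓝 1) := by
  have h1 : Tendsto (fun x : ℝ => Real.log ((⌊Real.exp x⌋₊ : ℝ) / Real.exp x)) atTop (𝓝 0) := by
    have := ((tendsto_nat_floor_div_atTop (R := ℝ)).comp Real.tendsto_exp_atTop).log one_ne_zero
    simpa using this
  have h2 : Tendsto (fun x : ℝ => 1 + Real.log ((⌊Real.exp x⌋₊ : ℝ) / Real.exp x) * x⁻¹) atTop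
      (𝓝 (1 + 0 * 0)) := (h1.mul tendsto_inv_atTop_zero).const_add 1
  simp only [mul_zero, add_zero] at h2
  refine h2.congr' ?_
  filter_upwards [eventually_gt_atTop 0] with x hx
  have hf : (0 : ℝ) < ⌊Real.exp x⌋₊ := by
    exact_mod_cast Nat.floor_pos.2 (Real.one_le_exp hx.le)
  rw [Real.log_div hf.ne' (Real.exp_pos x).ne', Real.log_exp]
  field_simp
  ring

theorem tendsto_log_eulerProd_floor_exp_sub_log {c K : ℝ} (h : ∀ n : ℕ, 2 ≤ n →
      |Real.log (eulerProd n) - Real.log (Real.log n) - c| ≤ K / Real.log n) :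
    Tendsto (fun x : ℝ => Real.log (eulerProd ⌊Real.exp x⌋₊) - Real.log x) atTop (𝓝 c) := by
  have hfl : Tendsto (fun x : ℝ => ⌊Real.exp x⌋₊) atTop atTop :=
    tendsto_nat_floor_atTop.comp Real.tendsto_exp_atTop
  have hn : Tendsto (fun n : ℕ => Real.log (eulerProd n) - Real.log (Real.log n) - c) atTop
      (𝓝 0) := by
    have hK : Tendsto (fun n : ℕ => K / Real.log n) atTop (𝓝 0) :=
      tendsto_const_nhds.div_atTop (Real.tendsto_log_atTop.comp tendsto_natCast_atTop_atTop)
    refine squeeze_zero_norm' ?_ hK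
    filter_upwards [eventually_ge_atTop 2] with n hn using h n hn
  have h1 := ((hn.comp hfl).add (tendsto_log_floor_exp_div.log one_ne_zero)).add_const c
  simp only [Real.log_one, add_zero, zero_add] at h1
  refine h1.congr' ?_
  filter_upwards [eventually_gt_atTop 1] with x hx
  have hf : (2 : ℝ) ≤ ⌊Real.exp x⌋₊ := by
    have : 2 ≤ ⌊Real.exp x⌋₊ := Nat.le_floor (by
      have := Real.add_one_le_exp x
      push_cast; linarith)
    exact_mod_cast this
  have hlf : 0 < Real.log ⌊Real.exp x⌋₊ := Real.log_pos (by linarith)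
  simp only [Function.comp]
  rw [Real.log_div hlf.ne' (by linarith)]
  ring

theorem tendsto_harmonic_floor_sub_log :
    Tendsto (fun x : ℝ => ((harmonic ⌊x⌋₊ : ℚ) : ℝ) - Real.log x) atTop
      (𝓝 Real.eulerMascheroniConstant) := by
  have h1 := (Real.tendsto_harmonic_sub_log.comp (tendsto_nat_floor_atTop (α := ℝ))).add
    ((tendsto_nat_floor_div_atTop (R := ℝ)).log one_ne_zero)
  simp only [Real.log_one, add_zero] at h1
  refine h1.congr' ?_
  filter_upwards [eventually_ge_atTop 1] with x hx
  have hf : (0 : ℝ) < ⌊x⌋₊ := by exact_mod_cast Nat.floor_pos.2 hx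
  simp only [Function.comp]
  rw [Real.log_div hf.ne' (by linarith)]
  ring

theorem monotone_harmonic : Monotone fun n : ℕ => ((harmonic n : ℚ) : ℝ) := by
  refine monotone_nat_of_le_succ fun n => ?_
  rw [harmonic_succ]
  push_cast
  have : (0 : ℝ) ≤ ((n : ℝ) + 1)⁻¹ := by positivity
  linarith

theorem harmonic_cast_nonneg (n : ℕ) : (0 : ℝ) ≤ ((harmonic n : ℚ) : ℝ) := by
  simpa using monotone_harmonic (Nat.zero_le n)

theorem tsum_primes_log_le {x : ℝ} :
    ∑' p : Nat.Primes, (if Real.log (p : ℕ) ≤ x then eulerWeight p else 0) =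
      Real.log (eulerProd ⌊Real.exp x⌋₊) := by
  have h := tsum_subtype {p : ℕ | p.Prime}
    (fun p : ℕ => if Real.log p ≤ x then eulerWeight p else 0)
  refine h.trans ?_
  rw [tsum_eq_sum (s := Nat.primesLE ⌊Real.exp x⌋₊), log_eulerProd]
  · refine sum_congr rfl fun p hp => ?_
    have hpp := Nat.prime_of_mem_primesLE hp
    rw [Set.indicator_of_mem (show p ∈ {p : ℕ | p.Prime} from hpp), if_pos]
    rw [Real.log_le_iff_le_exp (by exact_mod_cast hpp.pos)]
    exact (Nat.le_floor_iff (Real.exp_pos x).le).1 (Nat.le_of_mem_primesLE hp)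
  · intro p hp
    by_cases hpp : p.Prime
    · rw [Set.indicator_of_mem (show p ∈ {p : ℕ | p.Prime} from hpp), if_neg]
      rw [Real.log_le_iff_le_exp (by exact_mod_cast hpp.pos)]
      intro h
      exact hp (Nat.mem_primesLE.2 ⟨(Nat.le_floor_iff (Real.exp_pos x).le).2 h, hpp⟩)
    · exact Set.indicator_of_notMem hpp _

theorem tsum_inv_succ_le {x : ℝ} (hx : 0 < x) :
    ∑' n : ℕ, (if (n : ℝ) + 1 ≤ x then ((n : ℝ) + 1)⁻¹ else 0) = ((harmonic ⌊x⌋₊ : ℚ) : ℝ) := by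
  rw [tsum_eq_sum (s := range ⌊x⌋₊), harmonic]
  · push_cast
    refine sum_congr rfl fun n hn => ?_
    rw [if_pos]
    have := (Nat.le_floor_iff hx.le).1 (Nat.succ_le_of_lt (mem_range.1 hn))
    push_cast at this
    exact this
  · intro n hn
    rw [if_neg]
    intro h
    apply hn
    rw [mem_range]
    exact Nat.lt_of_succ_le ((Nat.le_floor_iff hx.le).2 (by push_cast; exact h))

/-! ### Behaviour of the transforms as ε tends to 0 -/

theorem summable_primes_inv_sq : Summable fun p : Nat.Primes => ((p : ℕ) : ℝ)⁻¹ ^ 2 := by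
  have := Nat.Primes.summable_rpow.2 (show (-2 : ℝ) < -1 by norm_num)
  refine this.congr fun p => ?_
  rw [Real.rpow_neg (Nat.cast_nonneg _), inv_pow]
  norm_cast

theorem rpow_neg_one_add {x ε : ℝ} (hx : 0 < x) :
    x ^ (-(1 + ε)) = x⁻¹ * Real.exp (-(ε * Real.log x)) := by
  rw [neg_add, Real.rpow_add hx, Real.rpow_neg_one, Real.rpow_def_of_pos hx]
  ring_nf

theorem summable_primes_inv_mul_exp {ε : ℝ} (hε : 0 < ε) :
    Summable fun p : Nat.Primes => ((p : ℕ) : ℝ)⁻¹ * Real.exp (-(ε * Real.log (p : ℕ))) := by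
  have := Nat.Primes.summable_rpow.2 (show -(1 + ε) < -1 by linarith)
  refine this.congr fun p => ?_
  exact rpow_neg_one_add (by exact_mod_cast p.2.pos)

theorem exp_neg_mul_log_mem {ε : ℝ} (hε : 0 < ε) (p : Nat.Primes) :
    0 < Real.exp (-(ε * Real.log (p : ℕ))) ∧ Real.exp (-(ε * Real.log (p : ℕ))) ≤ 1 :=
  ⟨Real.exp_pos _, Real.exp_le_one_iff.2
    (neg_nonpos.2 (mul_nonneg hε.le (Real.log_natCast_nonneg _)))⟩

theorem Nat.Primes.inv_le_half (p : Nat.Primes) : ((p : ℕ) : ℝ)⁻¹ ≤ 1 / 2 := by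
  rw [inv_eq_one_div]
  exact one_div_le_one_div_of_le (by norm_num) (by exact_mod_cast p.2.two_le)

theorem neg_log_one_sub_le_two_mul {x : ℝ} (hx0 : 0 ≤ x) (hx : x ≤ 1 / 2) :
    -Real.log (1 - x) ≤ 2 * x := by
  refine (neg_log_one_sub_le (by linarith)).trans ?_
  rw [div_le_iff₀ (by linarith)]
  nlinarith

theorem neg_log_one_sub_le_add_sq {x : ℝ} (hx : x ≤ 1 / 2) :
    -Real.log (1 - x) ≤ x + 2 * x ^ 2 := by
  refine (neg_log_one_sub_le (by linarith)).trans ?_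
  rw [div_le_iff₀ (by linarith)]
  nlinarith [sq_nonneg x, mul_nonneg (sq_nonneg x) (show 0 ≤ 1 - 2 * x by linarith)]

theorem summable_neg_log_euler {ε : ℝ} (hε : 0 < ε) :
    Summable fun p : Nat.Primes =>
      -Real.log (1 - ((p : ℕ) : ℝ)⁻¹ * Real.exp (-(ε * Real.log (p : ℕ)))) := by
  refine Summable.of_nonneg_of_le (fun p => ?_) (fun p => ?_)
    ((summable_primes_inv_mul_exp hε).mul_left 2)
  all_goals
    have h1 := exp_neg_mul_log_mem hε p
    have h2 := p.inv_le_half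
    have h0 : (0 : ℝ) ≤ ((p : ℕ) : ℝ)⁻¹ := by positivity
    have h3 : 0 ≤ ((p : ℕ) : ℝ)⁻¹ * Real.exp (-(ε * Real.log (p : ℕ))) := mul_nonneg h0 h1.1.le
    have h4 : ((p : ℕ) : ℝ)⁻¹ * Real.exp (-(ε * Real.log (p : ℕ))) ≤ 1 / 2 := by nlinarith
  · exact h3.trans (le_neg_log_one_sub (by linarith))
  · exact neg_log_one_sub_le_two_mul h3 h4

theorem summable_eulerWeight_mul_exp {ε : ℝ} (hε : 0 < ε) :
    Summable fun p : Nat.Primes => eulerWeight p * Real.exp (-(ε * Real.log (p : ℕ))) := by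
  refine Summable.of_nonneg_of_le (fun p => ?_) (fun p => ?_)
    ((summable_primes_inv_mul_exp hε).mul_left 2)
  · exact mul_nonneg (eulerWeight_nonneg _) (Real.exp_pos _).le
  · rw [← mul_assoc]
    exact mul_le_mul_of_nonneg_right (neg_log_one_sub_le_two_mul (by positivity) p.inv_le_half)
      (Real.exp_pos _).le

/-- The logarithm of the Euler product of `ζ` on the real axis. -/
theorem tsum_neg_log_euler {ε : ℝ} (hε : 0 < ε) :
    ∑' p : Nat.Primes, -Real.log (1 - ((p : ℕ) : ℝ)⁻¹ * Real.exp (-(ε * Real.log (p : ℕ)))) =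
      Real.log (∑' n : ℕ, 1 / (n : ℝ) ^ (1 + ε)) := by
  let f : ℕ →*₀ ℝ :=
    { toFun := fun n => (n : ℝ) ^ (-(1 + ε))
      map_zero' := by
        rw [Nat.cast_zero, Real.zero_rpow (by linarith)]
      map_one' := by simp
      map_mul' := fun m n => by
        rw [Nat.cast_mul, Real.mul_rpow (Nat.cast_nonneg _) (Nat.cast_nonneg _)] }
  have hf : ∀ n : ℕ, f n = 1 / (n : ℝ) ^ (1 + ε) := fun n => by
    change (n : ℝ) ^ (-(1 + ε)) = _
    rw [Real.rpow_neg (Nat.cast_nonneg _), one_div]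
  have hs : Summable fun n : ℕ => ‖f n‖ := by
    have := Real.summable_one_div_nat_rpow.2 (show 1 < 1 + ε by linarith)
    refine this.norm.congr fun n => ?_
    rw [hf]
  have h1 := EulerProduct.eulerProduct_completely_multiplicative_hasProd hs
  have hfp : ∀ p : Nat.Primes,
      f p = ((p : ℕ) : ℝ)⁻¹ * Real.exp (-(ε * Real.log (p : ℕ))) := fun p =>
    rpow_neg_one_add (by exact_mod_cast p.2.pos)
  have hlt : ∀ p : Nat.Primes, 0 < 1 - f p := fun p => by
    have h1 := exp_neg_mul_log_mem hε p
    have h2 := p.inv_le_half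
    have h0 : (0 : ℝ) ≤ ((p : ℕ) : ℝ)⁻¹ := by positivity
    rw [hfp]
    nlinarith
  have h2 : HasSum (fun p : Nat.Primes => Real.log (1 - f p)⁻¹)
      (∑' p : Nat.Primes,
        -Real.log (1 - ((p : ℕ) : ℝ)⁻¹ * Real.exp (-(ε * Real.log (p : ℕ))))) := by
    convert (summable_neg_log_euler hε).hasSum using 2 with p
    rw [Real.log_inv, hfp]
  have h3 := Real.hasProd_of_hasSum_log (fun p => inv_pos.2 (hlt p)) h2
  have h4 := h3.unique h1
  rw [← Real.log_exp (∑' p : Nat.Primes, _), h4]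
  congr 1
  exact tsum_congr hf

/-- The sum is log ζ(1 + ε), and ε ζ(1 + ε) → 1. -/
theorem tendsto_tsum_neg_log_euler_add_log :
    Tendsto (fun ε : ℝ => ∑' p : Nat.Primes,
      -Real.log (1 - ((p : ℕ) : ℝ)⁻¹ * Real.exp (-(ε * Real.log (p : ℕ)))) + Real.log ε)
      (𝓝[>] 0) (𝓝 0) := by
  have hshift : Tendsto (fun ε : ℝ => 1 + ε) (𝓝[>] 0) (𝓝[>] 1) := by
    refine tendsto_nhdsWithin_iff.2 ⟨?_, ?_⟩
    · have : Tendsto (fun ε : ℝ => 1 + ε) (𝓝 0) (𝓝 (1 + 0)) := tendsto_id.const_add 1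
      rw [add_zero] at this
      exact this.mono_left nhdsWithin_le_nhds
    · filter_upwards [self_mem_nhdsWithin] with ε hε
      simpa using hε
  have h := (tendsto_sub_mul_tsum_nat_rpow.comp hshift).log one_ne_zero
  rw [Real.log_one] at h
  refine h.congr' ?_
  filter_upwards [self_mem_nhdsWithin] with ε hε
  have hε' : (0 : ℝ) < ε := hε
  rw [tsum_neg_log_euler hε']
  have hpos : 0 < ∑' n : ℕ, 1 / (n : ℝ) ^ (1 + ε) := by
    refine (Real.summable_one_div_nat_rpow.2 (by linarith)).tsum_pos (fun n => by positivity) 1 ?_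
    simp
  simp only [Function.comp, add_sub_cancel_left]
  rw [Real.log_mul hε'.ne' hpos.ne', add_comm]

/-- The transform of log P carries the weight p^(-ε) outside the logarithm, log ζ(1 + ε) inside.
Writing x = 1/p and y = p^(-ε), both terms lie in [xy, xy + 2x²], so their difference is dominated
by 2/p², and it vanishes at ε = 0. -/
theorem tendsto_tsum_neg_log_euler_sub :
    Tendsto (fun ε : ℝ => ∑' p : Nat.Primes,
      (-Real.log (1 - ((p : ℕ) : ℝ)⁻¹ * Real.exp (-(ε * Real.log (p : ℕ)))) -
        eulerWeight p * Real.exp (-(ε * Real.log (p : ℕ))))) (𝓝[>] 0) (𝓝 0) := by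
  have h0 : ∑' _ : Nat.Primes, (0 : ℝ) = 0 := tsum_zero
  refine Eq.subst (motive := fun z => Tendsto _ _ (𝓝 z)) h0 ?_
  refine tendsto_tsum_of_dominated_convergence (summable_primes_inv_sq.mul_left 2) ?_ ?_
  · intro p
    have hne : 1 - ((p : ℕ) : ℝ)⁻¹ * Real.exp (-(0 * Real.log (p : ℕ))) ≠ 0 := by
      have := p.inv_le_half
      simp only [zero_mul, neg_zero, Real.exp_zero, mul_one]
      linarith
    have hc : ContinuousAt (fun ε : ℝ =>
        -Real.log (1 - ((p : ℕ) : ℝ)⁻¹ * Real.exp (-(ε * Real.log (p : ℕ)))) -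
          eulerWeight p * Real.exp (-(ε * Real.log (p : ℕ)))) 0 := by
      refine ContinuousAt.sub (ContinuousAt.neg (ContinuousAt.log ?_ hne)) ?_ <;> fun_prop
    have := hc.tendsto.mono_left (nhdsWithin_le_nhds (s := Set.Ioi 0))
    simpa [eulerWeight] using this
  · filter_upwards [self_mem_nhdsWithin] with ε hε p
    have h1 := exp_neg_mul_log_mem hε p
    have h2 := p.inv_le_half
    set y := Real.exp (-(ε * Real.log (p : ℕ)))
    set x := ((p : ℕ) : ℝ)⁻¹ with hx
    have h0 : 0 ≤ x := by positivity
    have h3 : 0 ≤ x * y := mul_nonneg h0 h1.1.le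
    have hxy : x * y ≤ x := mul_le_of_le_one_right h0 h1.2
    have e1 := le_neg_log_one_sub (show x * y < 1 by linarith)
    have e2 := neg_log_one_sub_le_add_sq (show x * y ≤ 1 / 2 by linarith)
    have e3 : x ≤ eulerWeight p := le_neg_log_one_sub (by linarith)
    have e4 : eulerWeight p ≤ x + 2 * x ^ 2 := neg_log_one_sub_le_add_sq h2
    have e5 : x * y ≤ eulerWeight p * y := mul_le_mul_of_nonneg_right e3 h1.1.le
    have e6 : eulerWeight p * y ≤ (x + 2 * x ^ 2) * y := mul_le_mul_of_nonneg_right e4 h1.1.le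
    have e7 : x ^ 2 * y ≤ x ^ 2 := mul_le_of_le_one_right (sq_nonneg _) h1.2
    have e8 : (x * y) ^ 2 ≤ x ^ 2 := pow_le_pow_left₀ h3 hxy 2
    rw [Real.norm_eq_abs, abs_le]
    constructor <;> nlinarith

theorem hasSum_inv_succ_mul_exp {ε : ℝ} (hε : 0 < ε) :
    HasSum (fun n : ℕ => ((n : ℝ) + 1)⁻¹ * Real.exp (-(ε * ((n : ℝ) + 1))))
      (-Real.log (1 - Real.exp (-ε))) := by
  have h1 : |Real.exp (-ε)| < 1 := by
    rw [abs_of_pos (Real.exp_pos _)]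
    exact Real.exp_lt_one_iff.2 (by linarith)
  convert Real.hasSum_pow_div_log_of_abs_lt_one h1 using 2 with n
  rw [← Real.exp_nat_mul, div_eq_inv_mul]
  push_cast
  ring_nf

/-- The quotient (1 - exp(-ε))/ε tends to the derivative 1 at 0. -/
theorem tendsto_neg_log_one_sub_exp_add_log :
    Tendsto (fun ε : ℝ => -Real.log (1 - Real.exp (-ε)) + Real.log ε) (𝓝[>] 0) (𝓝 0) := by
  have hd : HasDerivAt (fun ε : ℝ => 1 - Real.exp (-ε)) 1 0 := by
    have := ((hasDerivAt_neg (0 : ℝ)).exp).const_sub 1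
    simpa using this
  have h1 := (hasDerivAt_iff_tendsto_slope_zero.1 hd).mono_left
    (nhdsWithin_mono 0 (fun x (hx : 0 < x) => hx.ne'))
  have h2 := (h1.log one_ne_zero).neg
  simp only [Real.log_one, neg_zero] at h2
  refine h2.congr' ?_
  filter_upwards [self_mem_nhdsWithin] with ε hε
  have hε' : (0 : ℝ) < ε := hε
  have h3 : 0 < 1 - Real.exp (-ε) := by
    have := Real.exp_lt_one_iff.2 (show -ε < 0 by linarith)
    linarith
  simp only [zero_add, Real.exp_zero, sub_self, sub_zero, smul_eq_mul]
  rw [Real.log_mul (inv_ne_zero hε'.ne') h3.ne', Real.log_inv]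
  ring

/-! ### The constant is γ; Mertens' third theorem -/

theorem eq_eulerMascheroniConstant {c K : ℝ} (h : ∀ n : ℕ, 2 ≤ n →
      |Real.log (eulerProd n) - Real.log (Real.log n) - c| ≤ K / Real.log n) :
    c = Real.eulerMascheroniConstant := by
  let S : ℝ → ℝ := fun x => Real.log (eulerProd ⌊Real.exp x⌋₊)
  let H : ℝ → ℝ := fun x => ((harmonic ⌊x⌋₊ : ℚ) : ℝ)
  have hS : Monotone S := fun x y hxy =>
    monotone_log_eulerProd (Nat.floor_mono (Real.exp_le_exp.2 hxy))
  have hH : Monotone H := fun x y hxy => monotone_harmonic (Nat.floor_mono hxy)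
  have hlim : Tendsto (fun x => S x - H x) atTop (𝓝 (c - Real.eulerMascheroniConstant)) := by
    refine ((tendsto_log_eulerProd_floor_exp_sub_log h).sub tendsto_harmonic_floor_sub_log).congr
      fun x => ?_
    simp only [S, H]; ring
  obtain ⟨B, hB⟩ := hS.abs_sub_le_of_tendsto hH (fun x => log_eulerProd_nonneg _)
    (fun x => harmonic_cast_nonneg _) hlim
  have hA := tendsto_integral_exp_neg_mul (fun x => S x - H x) (hS.measurable.sub hH.measurable) B
    (fun x _ => hB x) _ hlim
  have hT : ∀ ε : ℝ, 0 < ε → ∫ u in Set.Ioi (0 : ℝ), Real.exp (-u) * S (u / ε) =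
      ∑' p : Nat.Primes, eulerWeight p * Real.exp (-(ε * Real.log (p : ℕ))) := fun ε hε =>
    integral_exp_neg_mul_step (fun p : Nat.Primes => eulerWeight p)
      (fun p : Nat.Primes => Real.log (p : ℕ))
      (fun p => eulerWeight_nonneg _) (fun p => Real.log_natCast_nonneg _) S
      (fun x _ => tsum_primes_log_le) hε (summable_eulerWeight_mul_exp hε)
  have hN : ∀ ε : ℝ, 0 < ε → ∫ u in Set.Ioi (0 : ℝ), Real.exp (-u) * H (u / ε) =
      -Real.log (1 - Real.exp (-ε)) := fun ε hε => by
    rw [← (hasSum_inv_succ_mul_exp hε).tsum_eq]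
    exact integral_exp_neg_mul_step (fun n : ℕ => ((n : ℝ) + 1)⁻¹) (fun n : ℕ => (n : ℝ) + 1)
      (fun n => by positivity) (fun n => by positivity) H
      (fun x hx => tsum_inv_succ_le hx) hε (hasSum_inv_succ_mul_exp hε).summable
  have hlim0 : Tendsto (fun ε : ℝ => ∫ u in Set.Ioi (0 : ℝ),
      Real.exp (-u) * (S (u / ε) - H (u / ε))) (𝓝[>] 0) (𝓝 0) := by
    have h1 := (tendsto_tsum_neg_log_euler_add_log.sub tendsto_tsum_neg_log_euler_sub).sub
      tendsto_neg_log_one_sub_exp_add_log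
    simp only [sub_zero] at h1
    refine h1.congr' ?_
    filter_upwards [self_mem_nhdsWithin] with ε hε
    have hε' : (0 : ℝ) < ε := hε
    have hTpos : 0 < ∑' p : Nat.Primes, eulerWeight p * Real.exp (-(ε * Real.log (p : ℕ))) := by
      refine (summable_eulerWeight_mul_exp hε').tsum_pos
        (fun p => mul_nonneg (eulerWeight_nonneg _) (Real.exp_pos _).le) ⟨2, Nat.prime_two⟩ ?_
      refine mul_pos (lt_of_lt_of_le ?_ (inv_le_eulerWeight le_rfl)) (Real.exp_pos _)
      norm_num
    have hNpos : 0 < -Real.log (1 - Real.exp (-ε)) := by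
      have h1 := Real.exp_lt_one_iff.2 (show -ε < 0 by linarith)
      have h2 := Real.exp_pos (-ε)
      exact neg_pos.2 (Real.log_neg (by linarith) (by linarith))
    -- A non-integrable function has integral 0 by convention, so a nonzero value of the integral
    -- yields integrability.
    have i1 := MeasureTheory.Integrable.of_integral_ne_zero ((hT ε hε').trans_ne hTpos.ne')
    have i2 := MeasureTheory.Integrable.of_integral_ne_zero ((hN ε hε').trans_ne hNpos.ne')
    simp only [mul_sub]
    rw [MeasureTheory.integral_sub i1 i2, hT ε hε', hN ε hε',
      (summable_neg_log_euler hε').tsum_sub (summable_eulerWeight_mul_exp hε')]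
    ring
  have := tendsto_nhds_unique hA hlim0
  linarith

/-- Mertens' third theorem, in logarithmic form. -/
theorem exists_abs_log_eulerProd_sub_gamma_le :
    ∃ K : ℝ, ∀ n : ℕ, 2 ≤ n →
      |Real.log (eulerProd n) - Real.log (Real.log n) - Real.eulerMascheroniConstant| ≤
        K / Real.log n := by
  obtain ⟨c, K, h⟩ := exists_abs_log_eulerProd_sub_le
  obtain rfl := eq_eulerMascheroniConstant h
  exact ⟨K, h⟩

/-- Mertens' third theorem. -/
theorem exists_abs_eulerProd_sub_le :
    ∃ K : ℝ, 0 ≤ K ∧ ∀ n : ℕ, 2 ≤ n →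
      |eulerProd n - Real.exp Real.eulerMascheroniConstant * Real.log n| ≤ K := by
  obtain ⟨K, h⟩ := exists_abs_log_eulerProd_sub_gamma_le
  have hl2 : 0 < Real.log 2 := Real.log_pos (by norm_num)
  have hK : 0 ≤ K := by
    have := (abs_nonneg _).trans (h 2 le_rfl)
    push_cast at this
    rwa [le_div_iff₀ hl2, zero_mul] at this
  set g := Real.eulerMascheroniConstant
  refine ⟨Real.exp g * (K * Real.exp (K / Real.log 2)), by positivity, fun n hn => ?_⟩
  have hl : 0 < Real.log n := Real.log_pos (by exact_mod_cast hn)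
  set d := Real.log (eulerProd n) - Real.log (Real.log n) - g with hd
  have hP : eulerProd n = Real.exp g * Real.log n * Real.exp d := by
    have : Real.log (eulerProd n) = g + Real.log (Real.log n) + d := by rw [hd]; ring
    rw [← Real.exp_log (eulerProd_pos n), this, Real.exp_add, Real.exp_add, Real.exp_log hl]
  have hdn : |d| ≤ K / Real.log n := h n hn
  have hd2 : |d| ≤ K / Real.log 2 := hdn.trans (by
    gcongr
    exact_mod_cast hn)
  -- As |d| ≤ K / log n, this bound cancels the factor log n and leaves an O(1) error.
  have hexp : |Real.exp d - 1| ≤ |d| * Real.exp |d| := by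
    have a1 := Real.add_one_le_exp d
    have a2 := Real.add_one_le_exp (-d)
    have a3 : Real.exp d * Real.exp (-d) = 1 := by rw [← Real.exp_add]; simp
    have a4 : 0 < Real.exp d := Real.exp_pos d
    rcases le_total 0 d with h0 | h0
    · rw [abs_of_nonneg h0, abs_of_nonneg (by linarith)]
      nlinarith
    · rw [abs_of_nonpos h0, abs_of_nonpos (by linarith [Real.exp_le_one_iff.2 h0])]
      have := Real.one_le_exp (show 0 ≤ -d by linarith)
      nlinarith
  have : eulerProd n - Real.exp g * Real.log n =
      Real.exp g * (Real.log n * (Real.exp d - 1)) := by rw [hP]; ring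
  rw [this, abs_mul, abs_of_pos (Real.exp_pos g), abs_mul, abs_of_pos hl]
  refine mul_le_mul_of_nonneg_left ?_ (Real.exp_pos g).le
  calc Real.log n * |Real.exp d - 1| ≤ Real.log n * (K / Real.log n * Real.exp (K / Real.log 2)) := by
        refine mul_le_mul_of_nonneg_left (hexp.trans ?_) hl.le
        gcongr
    _ = K * Real.exp (K / Real.log 2) := by field_simp

/-! ### Partitions as positive integers -/

theorem prime_pdx {k : ℕ} (hk : 0 < k) : (pdx k).Prime := by
  rw [pdx, if_neg hk.ne']
  exact Nat.prime_nth_prime _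

theorem primeCounting_pdx {k : ℕ} (hk : 0 < k) : Nat.primeCounting (pdx k) = k := by
  have hp := prime_pdx hk
  rw [Nat.primeCounting, Nat.primeCounting', Nat.count_succ, if_pos hp, pdx, if_neg hk.ne',
    Nat.count_nth_of_infinite Nat.infinite_setOfPred_prime]
  omega

theorem pdx_primeCounting {p : ℕ} (hp : p.Prime) : pdx (Nat.primeCounting p) = p := by
  rw [Nat.primeCounting, Nat.primeCounting', Nat.count_succ, if_pos hp, pdx,
    if_neg (Nat.succ_ne_zero _), Nat.add_sub_cancel, Nat.nth_count hp]

theorem Nat.Prime.primeCounting_pos {p : ℕ} (hp : p.Prime) : 0 < Nat.primeCounting p := by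
  rw [Nat.primeCounting, Nat.primeCounting', Nat.count_succ, if_pos hp]
  omega

theorem pdx_mono {j k : ℕ} (hj : 0 < j) (hjk : j ≤ k) : pdx j ≤ pdx k := by
  rw [pdx, pdx, if_neg hj.ne', if_neg (by omega)]
  exact Nat.nth_monotone Nat.infinite_setOfPred_prime (by omega)

theorem Nat.primeCounting_le_sub_one (n : ℕ) : Nat.primeCounting n ≤ n - 1 := by
  rw [← Nat.primesLE_card_eq_primeCounting, Nat.primesLE_eq_filter_Icc_two]
  refine (card_filter_le _ _).trans_eq ?_
  rw [Nat.card_Icc]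
  omega

theorem primeFactorsList_supernorm {m : ℕ} (lam : Nat.Partition m) :
    ((supernorm lam).primeFactorsList : Multiset ℕ) = lam.parts.map pdx := by
  have h := Nat.primeFactorsList_unique (n := supernorm lam) (l := (lam.parts.map pdx).toList)
    (Multiset.prod_toList _) (fun p hp => by
      rw [Multiset.mem_toList, Multiset.mem_map] at hp
      obtain ⟨k, hk, rfl⟩ := hp
      exact prime_pdx (lam.parts_pos hk))
  rw [← Multiset.coe_eq_coe.2 h, Multiset.coe_toList]

theorem supernorm_ne_zero {m : ℕ} (lam : Nat.Partition m) : supernorm lam ≠ 0 := by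
  refine Multiset.prod_ne_zero fun h => ?_
  obtain ⟨k, hk, h0⟩ := Multiset.mem_map.1 h
  exact (prime_pdx (lam.parts_pos hk)).ne_zero h0

/-- The size of the partition with supernorm `m`. -/
def primeIndexSum (m : ℕ) : ℕ := (m.primeFactorsList.map Nat.primeCounting).sum

theorem map_primeCounting_supernorm {m : ℕ} (lam : Nat.Partition m) :
    ((supernorm lam).primeFactorsList : Multiset ℕ).map Nat.primeCounting = lam.parts := by
  rw [primeFactorsList_supernorm, Multiset.map_map]
  conv_rhs => rw [← Multiset.map_id lam.parts]
  exact Multiset.map_congr rfl fun k hk => primeCounting_pdx (lam.parts_pos hk)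

theorem primeIndexSum_supernorm {m : ℕ} (lam : Nat.Partition m) :
    primeIndexSum (supernorm lam) = m := by
  have h := congrArg Multiset.sum (map_primeCounting_supernorm lam)
  rwa [lam.parts_sum, Multiset.map_coe, Multiset.sum_coe] at h

theorem supernorm_sigma_injective :
    Function.Injective fun x : (Σ m : ℕ, Nat.Partition m) => supernorm x.2 := by
  rintro ⟨m, lam⟩ ⟨m', mu⟩ h
  simp only at h
  have hm : m = m' := by rw [← primeIndexSum_supernorm lam, h, primeIndexSum_supernorm]
  subst hm
  congr 1
  refine Nat.Partition.ext ?_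
  rw [← map_primeCounting_supernorm lam, h, map_primeCounting_supernorm]

theorem exists_supernorm_eq {k : ℕ} (hk : k ≠ 0) :
    ∃ lam : Nat.Partition (primeIndexSum k), supernorm lam = k := by
  refine ⟨⟨(k.primeFactorsList : Multiset ℕ).map Nat.primeCounting, ?_, ?_⟩, ?_⟩
  · intro i hi
    obtain ⟨p, hp, rfl⟩ := Multiset.mem_map.1 hi
    exact (Nat.prime_of_mem_primeFactorsList (Multiset.mem_coe.1 hp)).primeCounting_pos
  · rw [Multiset.map_coe, Multiset.sum_coe, primeIndexSum]
  · rw [supernorm, Multiset.map_map]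
    have : (k.primeFactorsList : Multiset ℕ).map (pdx ∘ Nat.primeCounting) =
        (k.primeFactorsList : Multiset ℕ) := by
      conv_rhs => rw [← Multiset.map_id (k.primeFactorsList : Multiset ℕ)]
      exact Multiset.map_congr rfl fun p hp =>
        pdx_primeCounting (Nat.prime_of_mem_primeFactorsList (Multiset.mem_coe.1 hp))
    rw [this, Multiset.prod_coe, Nat.prod_primeFactorsList hk]

theorem exists_finset_cumSize_eq (n : ℕ) :
    ∃ T : Finset ℕ, (∀ k, k ∈ T ↔ k ≠ 0 ∧ primeIndexSum k ≤ n) ∧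
      cumSize n = ∑ k ∈ T, (k : ℝ)⁻¹ := by
  let A : Finset (Σ m : ℕ, Nat.Partition m) := (range (n + 1)).sigma fun _ => univ
  refine ⟨A.image fun x => supernorm x.2, fun k => ?_, ?_⟩
  · rw [mem_image]
    constructor
    · rintro ⟨⟨m, lam⟩, hx, rfl⟩
      refine ⟨supernorm_ne_zero lam, ?_⟩
      rw [primeIndexSum_supernorm]
      have := (mem_sigma.1 hx).1
      rw [mem_range] at this
      omega
    · rintro ⟨h0, hn⟩
      obtain ⟨lam, hlam⟩ := exists_supernorm_eq h0
      exact ⟨⟨_, lam⟩, mem_sigma.2 ⟨mem_range.2 (Nat.lt_succ_of_le hn), mem_univ _⟩, hlam⟩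
  · rw [sum_image supernorm_sigma_injective.injOn, cumSize, sum_sigma]
    simp

/-! ### Euler products bounding the sum over partitions -/

theorem primeIndexSum_mul {m n : ℕ} (hm : m ≠ 0) (hn : n ≠ 0) :
    primeIndexSum (m * n) = primeIndexSum m + primeIndexSum n := by
  rw [primeIndexSum, ((Nat.perm_primeFactorsList_mul hm hn).map _).sum_eq, List.map_append,
    List.sum_append, primeIndexSum, primeIndexSum]

theorem primeIndexSum_prime {p : ℕ} (hp : p.Prime) :
    primeIndexSum p = Nat.primeCounting p := by
  simp [primeIndexSum, Nat.primeFactorsList_prime hp]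

/-- The completely multiplicative function `m ↦ z ^ |λ| / m`, where `λ` is the partition with
supernorm `m`. -/
noncomputable def sizeWeight (z : ℝ) : ℕ →* ℝ where
  toFun m := z ^ primeIndexSum m * (m : ℝ)⁻¹
  map_one' := by simp [primeIndexSum]
  map_mul' m n := by
    -- At 0 the weight is 0, because 0⁻¹ = 0.
    rcases eq_or_ne m 0 with rfl | hm
    · simp
    rcases eq_or_ne n 0 with rfl | hn
    · simp
    rw [primeIndexSum_mul hm hn, pow_add, Nat.cast_mul, mul_inv]
    ring

theorem sizeWeight_apply (z : ℝ) (m : ℕ) : sizeWeight z m = z ^ primeIndexSum m * (m : ℝ)⁻¹ := rfl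

theorem hasSum_sizeWeight {z : ℝ} (hz0 : 0 ≤ z) (hz1 : z ≤ 1) (n : ℕ) :
    HasSum (fun m : (n + 1).smoothNumbers => sizeWeight z m)
      (∏ p ∈ Nat.primesLE n, (1 - z ^ Nat.primeCounting p * (p : ℝ)⁻¹)⁻¹) := by
  have h := (EulerProduct.summable_and_hasSum_smoothNumbers_prod_primesBelow_geometric
    (f := sizeWeight z) (fun {p} hp => ?_) (n + 1)).2
  · have e : ∏ p ∈ Nat.primesLE n, (1 - z ^ Nat.primeCounting p * (p : ℝ)⁻¹)⁻¹ =
        ∏ p ∈ Nat.primesLE n, (1 - sizeWeight z p)⁻¹ := prod_congr rfl fun p hp => by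
      rw [sizeWeight_apply, primeIndexSum_prime (Nat.prime_of_mem_primesLE hp)]
    rw [e]
    exact h
  · rw [sizeWeight_apply, Real.norm_of_nonneg (by positivity)]
    have h1 := one_div_prime_lt_one hp.two_le
    have h2 : z ^ primeIndexSum p ≤ 1 := pow_le_one₀ hz0 hz1
    exact (mul_le_of_le_one_left (by positivity) h2).trans_lt h1

theorem hasSum_inv_smoothNumbers (n : ℕ) :
    HasSum (fun m : (n + 1).smoothNumbers => ((m : ℕ) : ℝ)⁻¹) (eulerProd n) := by
  have := hasSum_sizeWeight zero_le_one le_rfl n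
  simpa [sizeWeight_apply, eulerProd] using this

/-- A prime dividing k has index at most `primeIndexSum k`, so every k in the sum is p_n-smooth. -/
theorem cumSize_le_eulerProd (n : ℕ) : cumSize n ≤ eulerProd (pdx n) := by
  obtain ⟨T, hT, hsum⟩ := exists_finset_cumSize_eq n
  rw [hsum]
  have hsm : ∀ k ∈ T, k ∈ (pdx n + 1).smoothNumbers := by
    intro k hk
    obtain ⟨h0, hle⟩ := (hT k).1 hk
    refine ⟨h0, fun p hp => Nat.lt_succ_of_le ?_⟩
    have hpp := Nat.prime_of_mem_primeFactorsList hp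
    have h1 : Nat.primeCounting p ≤ primeIndexSum k :=
      List.single_le_sum (by simp) _ (List.mem_map_of_mem hp)
    rw [← pdx_primeCounting hpp]
    exact pdx_mono hpp.primeCounting_pos (h1.trans hle)
  have h := hasSum_inv_smoothNumbers (pdx n)
  have h2 := sum_le_hasSum (T.subtype (· ∈ (pdx n + 1).smoothNumbers))
    (fun i _ => by positivity) h
  refine le_trans (le_of_eq ?_) h2
  rw [sum_subtype_of_mem (fun k : ℕ => (k : ℝ)⁻¹) hsm]

/-- Bernoulli and π(p) ≤ p - 1 give z^π(p) ≥ 1 - (p - 1)/n for z = 1 - 1/n. Then 1 - z^π(p)/p ≤ (1 -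
1/p)(1 + 1/n), and z(1 + 1/n) ≤ 1. -/
theorem mul_one_sub_inv_le_of_prime {n p : ℕ} (hn : 2 ≤ n) (hp : p.Prime) :
    (1 - (n : ℝ)⁻¹) * (1 - (p : ℝ)⁻¹)⁻¹ ≤
      (1 - (1 - (n : ℝ)⁻¹) ^ Nat.primeCounting p * (p : ℝ)⁻¹)⁻¹ := by
  set z : ℝ := 1 - (n : ℝ)⁻¹ with hz
  have hn2 : (2 : ℝ) ≤ n := by exact_mod_cast hn
  have hn1 : (n : ℝ)⁻¹ < 1 := one_div_prime_lt_one hn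
  have hn0 : (0 : ℝ) < (n : ℝ)⁻¹ := by positivity
  have hp1 : (p : ℝ)⁻¹ < 1 := one_div_prime_lt_one hp.two_le
  have hp0 : (0 : ℝ) < (p : ℝ)⁻¹ := inv_pos.2 (by exact_mod_cast hp.pos)
  have hpp : (p : ℝ) * (p : ℝ)⁻¹ = 1 := mul_inv_cancel₀ (by exact_mod_cast hp.ne_zero)
  have hzk1 : z ^ Nat.primeCounting p ≤ 1 := pow_le_one₀ (by linarith) (by linarith)
  have hk : ((Nat.primeCounting p : ℕ) : ℝ) ≤ p - 1 := by
    rw [← Nat.cast_pred hp.pos]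
    exact_mod_cast Nat.primeCounting_le_sub_one p
  have hb : 1 - ((p : ℝ) - 1) * (n : ℝ)⁻¹ ≤ z ^ Nat.primeCounting p := by
    have := one_add_mul_le_pow (show (-2 : ℝ) ≤ -(n : ℝ)⁻¹ by linarith) (Nat.primeCounting p)
    rw [← sub_eq_add_neg 1, ← hz] at this
    nlinarith
  have hpos : 0 < 1 - z ^ Nat.primeCounting p * (p : ℝ)⁻¹ := by nlinarith
  rw [← div_eq_mul_inv, ← one_div (1 - z ^ _ * _), div_le_div_iff₀ (by linarith) hpos, one_mul]
  have h1 : z ^ Nat.primeCounting p * (p : ℝ)⁻¹ ≥ (p : ℝ)⁻¹ - (1 - (p : ℝ)⁻¹) * (n : ℝ)⁻¹ := by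
    have h := mul_le_mul_of_nonneg_right hb hp0.le
    have e : (1 - ((p : ℝ) - 1) * (n : ℝ)⁻¹) * (p : ℝ)⁻¹ =
        (p : ℝ)⁻¹ - ((p : ℝ) * (p : ℝ)⁻¹ - (p : ℝ)⁻¹) * (n : ℝ)⁻¹ := by ring
    rw [e, hpp] at h
    exact h
  calc z * (1 - z ^ Nat.primeCounting p * (p : ℝ)⁻¹)
      ≤ z * ((1 - (p : ℝ)⁻¹) * (1 + (n : ℝ)⁻¹)) := by
        refine mul_le_mul_of_nonneg_left ?_ (by linarith)
        linarith
    _ = (1 - (p : ℝ)⁻¹) * (1 - (n : ℝ)⁻¹ ^ 2) := by rw [hz]; ring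
    _ ≤ 1 - (p : ℝ)⁻¹ := mul_le_of_le_one_right (by linarith) (by nlinarith)

theorem eulerProd_mul_le_cumSize {n : ℕ} (hn : 2 ≤ n) :
    eulerProd n * (1 - 2 * (Nat.primeCounting n / n)) ≤ cumSize n := by
  obtain ⟨T, hT, hcum⟩ := exists_finset_cumSize_eq n
  have hn2 : (2 : ℝ) ≤ n := by exact_mod_cast hn
  have hn1 : (n : ℝ)⁻¹ < 1 := one_div_prime_lt_one hn
  have hn0 : (0 : ℝ) < (n : ℝ)⁻¹ := by positivity
  set z : ℝ := 1 - (n : ℝ)⁻¹ with hz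
  have hz0 : 0 < z := by linarith
  have hz1 : z ≤ 1 := by linarith
  set P := eulerProd n with hP
  have hP0 : 0 < P := eulerProd_pos n
  -- (1 - 1/n)^n ≤ 1/e; this is where the factor 2 in the statement comes from.
  have hzn : z ^ n ≤ 1 / 2 := by
    have h1 := Real.one_sub_div_pow_le_exp_neg (n := n) (t := 1) (by linarith)
    rw [one_div, ← hz] at h1
    refine h1.trans ?_
    rw [Real.exp_neg, ← one_div]
    exact one_div_le_one_div_of_le (by norm_num) (by linarith [Real.add_one_le_exp 1])
  set F := ∏ p ∈ Nat.primesLE n, (1 - z ^ Nat.primeCounting p * (p : ℝ)⁻¹)⁻¹ with hF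
  have hFP : z ^ Nat.primeCounting n * P ≤ F := by
    rw [← Nat.primesLE_card_eq_primeCounting, ← prod_const, hP, eulerProd, ← prod_mul_distrib]
    refine prod_le_prod (fun p hp => ?_) fun p hp =>
      mul_one_sub_inv_le_of_prime hn (Nat.prime_of_mem_primesLE hp)
    have := one_div_prime_lt_one (Nat.two_le_of_mem_primesLE hp)
    exact mul_nonneg hz0.le (inv_nonneg.2 (by linarith))
  -- Sum of the minorant (z^s - z^n)/(1 - z^n), weighted by 1/m: at most 1 for every size s, and
  -- nonpositive once s ≥ n.
  have hS := ((hasSum_sizeWeight hz0.le hz1 n).sub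
    ((hasSum_inv_smoothNumbers n).mul_left (z ^ n))).div_const (1 - z ^ n)
  have hle : (F - z ^ n * P) / (1 - z ^ n) ≤ cumSize n := by
    refine hasSum_le_of_sum_le hS fun s => ?_
    have hterm : ∀ k : ℕ, k ≠ 0 → (sizeWeight z k - z ^ n * (k : ℝ)⁻¹) / (1 - z ^ n) ≤
        if k ∈ T then (k : ℝ)⁻¹ else 0 := by
      intro k hk
      have hk0 : (0 : ℝ) ≤ (k : ℝ)⁻¹ := by positivity
      rw [sizeWeight_apply, ← sub_mul, div_le_iff₀ (by linarith)]
      split_ifs with h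
      · have := pow_le_one₀ (n := primeIndexSum k) hz0.le hz1
        nlinarith
      · have hlt : n ≤ primeIndexSum k := by
          by_contra hc
          exact h ((hT k).2 ⟨hk, by omega⟩)
        have := pow_le_pow_of_le_one hz0.le hz1 hlt
        nlinarith
    calc ∑ m ∈ s, (sizeWeight z m - z ^ n * ((m : ℕ) : ℝ)⁻¹) / (1 - z ^ n)
        ≤ ∑ m ∈ s, if (m : ℕ) ∈ T then ((m : ℕ) : ℝ)⁻¹ else 0 :=
          sum_le_sum fun m _ => hterm m m.2.1
      _ = ∑ k ∈ s.map (Function.Embedding.subtype _), if k ∈ T then (k : ℝ)⁻¹ else 0 := by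
          rw [sum_map]; rfl
      _ ≤ ∑ k ∈ T, (k : ℝ)⁻¹ := by
          rw [← sum_filter]
          refine sum_le_sum_of_subset_of_nonneg (fun k hk => (mem_filter.1 hk).2) fun k _ _ => ?_
          positivity
      _ = cumSize n := hcum.symm
  refine le_trans ?_ hle
  have hbern : 1 - (Nat.primeCounting n : ℝ) / n ≤ z ^ Nat.primeCounting n := by
    have := one_add_mul_le_pow (show (-2 : ℝ) ≤ -(n : ℝ)⁻¹ by linarith) (Nat.primeCounting n)
    rw [← sub_eq_add_neg 1, ← hz] at this
    rw [div_eq_mul_inv]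
    linarith
  have hr : 0 ≤ (Nat.primeCounting n : ℝ) / n := by positivity
  rw [le_div_iff₀ (by linarith)]
  have h1 : P * (1 - (Nat.primeCounting n : ℝ) / n) ≤ F := by nlinarith
  have hzn0 : 0 < z ^ n := by positivity
  have h2 : (1 - 2 * ((Nat.primeCounting n : ℝ) / n)) * (1 - z ^ n) ≤
      1 - (Nat.primeCounting n : ℝ) / n - z ^ n := by nlinarith
  nlinarith [mul_le_mul_of_nonneg_left h2 hP0.le]

/-! ### Chebyshev estimates for π(n) and p_n -/

theorem Real.log_le_two_mul_sqrt {x : ℝ} (hx : 0 ≤ x) : Real.log x ≤ 2 * √x := by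
  have := Real.log_le_rpow_div hx (show (0 : ℝ) < 1 / 2 by norm_num)
  rw [← Real.sqrt_eq_rpow] at this
  linarith

theorem primeCounting_mul_log_le {n : ℕ} (hn : 2 ≤ n) :
    (Nat.primeCounting n : ℝ) * Real.log n ≤ (2 * Real.log 4 + 2) * n := by
  have hn1 : (1 : ℝ) < n := by exact_mod_cast hn
  have hl : 0 < Real.log n := Real.log_pos hn1
  have h := Chebyshev.pi_le_log4_mul_div hn1
  rw [Nat.floor_natCast, Real.log_sqrt (by linarith)] at h
  have hs : √(n : ℝ) * Real.log n ≤ 2 * n := by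
    have h1 := Real.log_le_two_mul_sqrt (show (0 : ℝ) ≤ n by linarith)
    have h2 := Real.mul_self_sqrt (show (0 : ℝ) ≤ n by linarith)
    nlinarith [Real.sqrt_nonneg (n : ℝ)]
  calc (Nat.primeCounting n : ℝ) * Real.log n
      ≤ (Real.log 4 * n / (Real.log n / 2) + √(n : ℝ)) * Real.log n := by gcongr
    _ = 2 * Real.log 4 * n + √(n : ℝ) * Real.log n := by field_simp
    _ ≤ _ := by linarith

theorem log_pdx_le {n : ℕ} (hn : 10 ≤ n) :
    Real.log (pdx n) ≤ Real.log n + Real.log (Real.log n) + Real.log 12 := by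
  have hn10 : (10 : ℝ) ≤ n := by exact_mod_cast hn
  have hpp := prime_pdx (show 0 < n by omega)
  have hpi := primeCounting_pdx (show 0 < n by omega)
  set p := pdx n
  have hp2 : (2 : ℝ) ≤ p := by exact_mod_cast hpp.two_le
  have hp0 : (0 : ℝ) < p := by linarith
  have hlp : 0 < Real.log p := Real.log_pos (by linarith)
  have hln : 0 < Real.log n := Real.log_pos (by linarith)
  have h := Chebyshev.pi_ge p
  rw [hpi, div_le_iff₀ hlp] at h
  have h1 : Real.log ((p : ℝ) + 1) ≤ 2 * Real.log p := by
    rw [← Nat.cast_two (R := ℝ), ← Real.log_pow]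
    exact Real.log_le_log (by linarith) (by nlinarith)
  have hl2 := Real.log_two_gt_d9
  -- Bootstrap: log p ≤ 2√p turns this into √p ≤ 6n, hence p ≤ 36n² ≤ n⁴ and log p ≤ 4 log n.
  -- Reinserting gives p ≤ 12 n log n.
  have h2 : (p : ℝ) ≤ 3 * n * Real.log p := by nlinarith
  have hsq := Real.mul_self_sqrt hp0.le
  have hs0 : 0 < √(p : ℝ) := Real.sqrt_pos.2 hp0
  have h3 : √(p : ℝ) ≤ 6 * n := by
    have := Real.log_le_two_mul_sqrt hp0.le
    have h4 : √(p : ℝ) * √(p : ℝ) ≤ 6 * n * √(p : ℝ) := by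
      rw [hsq]
      nlinarith
    exact le_of_mul_le_mul_right h4 hs0
  have h4 : (p : ℝ) ≤ (n : ℝ) ^ 4 := by
    have a1 : (p : ℝ) ≤ 36 * n ^ 2 := by nlinarith
    have a2 : (36 : ℝ) ≤ n ^ 2 := by nlinarith
    nlinarith [sq_nonneg (n : ℝ)]
  have h5 : Real.log p ≤ 4 * Real.log n := by
    have := Real.log_le_log hp0 h4
    rw [Real.log_pow] at this
    exact_mod_cast this
  have h6 : (p : ℝ) ≤ n * Real.log n * 12 := by nlinarith
  have h7 := Real.log_le_log hp0 h6
  rwa [Real.log_mul (by positivity) (by norm_num), Real.log_mul (by positivity) hln.ne'] at h7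

/-! ### The two bounds and the conclusion -/

theorem exists_le_cumSize :
    ∃ C : ℝ, ∀ n : ℕ, 10 ≤ n →
      Real.exp Real.eulerMascheroniConstant * Real.log n - C ≤ cumSize n := by
  obtain ⟨K, hK0, hK⟩ := exists_abs_eulerProd_sub_le
  set g := Real.exp Real.eulerMascheroniConstant
  have hg : 0 < g := Real.exp_pos _
  refine ⟨K + 2 * ((g + K) * (2 * Real.log 4 + 2)), fun n hn => ?_⟩
  have hn10 : (10 : ℝ) ≤ n := by exact_mod_cast hn
  have hln : 1 ≤ Real.log n := by
    rw [Real.le_log_iff_exp_le (by linarith)]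
    linarith [Real.exp_one_lt_d9]
  have h1 := abs_le.1 (hK n (by omega))
  have h2 := eulerProd_mul_le_cumSize (show 2 ≤ n by omega)
  have h3 := primeCounting_mul_log_le (show 2 ≤ n by omega)
  have h4 : eulerProd n * ((Nat.primeCounting n : ℝ) / n) ≤ (g + K) * (2 * Real.log 4 + 2) := by
    have hP : eulerProd n ≤ (g + K) * Real.log n := by nlinarith
    calc eulerProd n * ((Nat.primeCounting n : ℝ) / n)
        ≤ ((g + K) * Real.log n) * ((Nat.primeCounting n : ℝ) / n) := by gcongr
      _ = (g + K) * ((Nat.primeCounting n * Real.log n) / n) := by ring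
      _ ≤ _ := by
        refine mul_le_mul_of_nonneg_left ?_ (by linarith)
        rwa [div_le_iff₀ (by linarith)]
  linarith

theorem exists_cumSize_le :
    ∃ C : ℝ, ∀ n : ℕ, 10 ≤ n →
      cumSize n ≤ Real.exp Real.eulerMascheroniConstant *
        (Real.log n + Real.log (Real.log n)) + C := by
  obtain ⟨K, hK0, hK⟩ := exists_abs_eulerProd_sub_le
  set g := Real.exp Real.eulerMascheroniConstant
  have hg : 0 < g := Real.exp_pos _
  refine ⟨g * Real.log 12 + K, fun n hn => ?_⟩
  have h1 := cumSize_le_eulerProd n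
  have h2 := abs_le.1 (hK _ (prime_pdx (show 0 < n by omega)).two_le)
  have h3 := mul_le_mul_of_nonneg_left (log_pdx_le hn) hg.le
  linarith

theorem theorem3p4 :
    (∃ C : ℝ, ∀ n : ℕ, 10 ≤ n →
      Real.exp Real.eulerMascheroniConstant * Real.log n - C ≤ cumSize n) ∧
    (∃ C : ℝ, ∀ n : ℕ, 10 ≤ n →
      |cumSize n - Real.exp Real.eulerMascheroniConstant * Real.log n| ≤
        C * Real.log (Real.log n)) := by
  refine ⟨exists_le_cumSize, ?_⟩
  obtain ⟨C₁, h₁⟩ := exists_le_cumSize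
  obtain ⟨C₂, h₂⟩ := exists_cumSize_le
  set g := Real.exp Real.eulerMascheroniConstant
  have hg : 0 < g := Real.exp_pos _
  have hl10 : 1 < Real.log 10 := by
    rw [Real.lt_log_iff_exp_lt (by norm_num)]
    linarith [Real.exp_one_lt_d9]
  set δ := Real.log (Real.log 10) with hδ
  have hδ0 : 0 < δ := Real.log_pos hl10
  -- For n ≥ 10, log log n ≥ δ > 0, so dividing by δ absorbs the additive constants.
  refine ⟨g + (|C₁| + |C₂|) / δ, fun n hn => ?_⟩
  have hn10 : (10 : ℝ) ≤ n := by exact_mod_cast hn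
  have hL : δ ≤ Real.log (Real.log n) :=
    Real.log_le_log (by linarith) (Real.log_le_log (by norm_num) hn10)
  have hc : |C₁| + |C₂| ≤ (|C₁| + |C₂|) / δ * Real.log (Real.log n) := by
    rw [div_mul_eq_mul_div, le_div_iff₀ hδ0]
    exact mul_le_mul_of_nonneg_left hL (by positivity)
  have a1 := h₁ n hn
  have a2 := h₂ n hn
  have b1 := le_abs_self C₁
  have b2 := le_abs_self C₂
  have b3 := abs_nonneg C₁
  have b4 := abs_nonneg C₂
  have b5 := mul_pos hg (hδ0.trans_le hL)
  rw [abs_le]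
  constructor <;> linarith
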